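/- Let $H$ be a separable complex Hilbert space and let $w=(w_k)_{k\ge 1}$ be a weight, that is, a sequence of non-negative reals with $w_k\ge w_{k+1}$ for all $k$ and $w_k\to 0$. For a compact operator $B$ on $H$ let $\lambda(B)=(\lambda_k(B))_{k\ge1}$ be its eigenvalue sequence: the non-zero eigenvalues, counted with algebraic multiplicity and ordered by decreasing modulus, followed by zeros if there are only finitely many of them. Let $s_k(B)=\sqrt{\lambda_k(B^*B)}$ be its singular values. Let $E_w(H)$ be the set of all compact operators $A$ on $H$ for which there is $M\ge 0$ with $s_k(A)\le M w_k$ for all $k\ge 1$, and let $|A|_w$ be the infimum of all such $M$. For a sequence $v$ of non-negative reals let $\mathcal E_v$ be the set of all complex sequences $x$ for which there is $M\ge 0$ with $|x_k|\le M v_k$ for all $k\ge 1$, and let $|x|_v$ be the infimum of all such $M$. Let $\bar w_k=(w_1\cdots w_k)^{1/k}$ for $k\ge1$. Proposition 3.12. If $A\in E_w(H)$, then $\lambda(A)\in\mathcal E_{\bar w}$ and $|\lambda(A)|_{\bar w}\le |A|_w$; moreover $|\lambda_k(A)|\le |A|_w\,\bar w_k$ for all $k\ge 1$. -/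

import Mathlib

/-!
Sequences indexed by the positive integers are represented by functions on `ℕ` starting
at index `0`: the value at `k : ℕ` is the `(k + 1)`-st term of the sequence.
-/

namespace CompactnessClass

open Module Filter Topology

section Eigenvalues

variable {H : Type*} [NormedAddCommGroup H] [InnerProductSpace ℂ H]

/-- The algebraic multiplicity of `μ` as an eigenvalue of `A`: the dimension of the generalised
eigenspace `⋃ n, ker (A - μ) ^ n`. -/
noncomputable def algebraicMultiplicity (A : H →L[ℂ] H) (μ : ℂ) : ℕ∞ :=
  Cardinal.toENat (Module.rank ℂ (End.maxGenEigenspace (A : End ℂ H) μ))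

/-- `l` lists the non-zero eigenvalues of `A`, each one as often as its algebraic multiplicity, by
decreasing modulus. If there are only finitely many of them, the remaining terms are `0`:
a term `l k ≠ 0` is an eigenvalue by `encard_eq`, and by `antitone` only zeros follow a zero. -/
structure IsEigenvalueSequence (A : H →L[ℂ] H) (l : ℕ → ℂ) : Prop where
  antitone : Antitone fun k => ‖l k‖
  encard_eq : ∀ μ : ℂ, μ ≠ 0 → {k | l k = μ}.encard = algebraicMultiplicity A μ

/-- There is no strictly increasing sequence of closed subspaces `V n` such that the compact
operator `A` acts on `V (n + 1) ⧸ V n` as a scalar that is bounded away from `0`. -/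
theorem not_strictMono_of_isCompactOperator {A : H →L[ℂ] H} (hA : IsCompactOperator A)
    {ε : ℝ} (hε : 0 < ε) {V : ℕ → Submodule ℂ H} (hcl : ∀ n, IsClosed (V n : Set H))
    {μ : ℕ → ℂ} (hμ : ∀ n, ε ≤ ‖μ n‖) (hV : ∀ n, ∀ x ∈ V (n + 1), A x - μ n • x ∈ V n) :
    ¬ StrictMono V := by
  intro hmono
  have hx (n : ℕ) : ∃ x ∈ V (n + 1), ‖x‖ ≤ 3 ∧ ∀ y ∈ V n, 1 ≤ ‖x - y‖ := by
    have h₁ : IsClosed ((V n).comap (V (n + 1)).subtype : Set (V (n + 1))) :=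
      (hcl n).preimage continuous_subtype_val
    have h₂ : ∃ x : V (n + 1), x ∉ (V n).comap (V (n + 1)).subtype := by
      obtain ⟨x, hx, hx'⟩ := SetLike.exists_of_lt (hmono (Nat.lt_succ_self n))
      exact ⟨⟨x, hx⟩, hx'⟩
    obtain ⟨⟨x, hx⟩, hxn, hxy⟩ :=
      riesz_lemma_of_norm_lt (c := (2 : ℂ)) (R := 3) (by norm_num) (by norm_num) h₁ h₂
    refine ⟨x, hx, hxn, fun y hy => ?_⟩
    exact hxy ⟨y, hmono.monotone (Nat.le_succ n) hy⟩ hy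
  choose x hxV hxn hxy using hx
  have hlt : ∀ m n, m < n → ε ≤ ‖A (x n) - A (x m)‖ := by
    intro m n hmn
    have hμn : μ n ≠ 0 := norm_pos_iff.mp (hε.trans_le (hμ n))
    have h1 : A (x m) ∈ V n := by
      have : A (x m) ∈ V (m + 1) := by
        have := (V (m + 1)).add_mem (hmono.monotone (Nat.le_succ m) (hV m _ (hxV m)))
          ((V (m + 1)).smul_mem (μ m) (hxV m))
        simpa using this
      exact hmono.monotone hmn this
    have h2 : A (x m) - (A (x n) - μ n • x n) ∈ V n := (V n).sub_mem h1 (hV n _ (hxV n))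
    have h3 := hxy n _ ((V n).smul_mem (μ n)⁻¹ h2)
    have h4 : A (x n) - A (x m)
        = μ n • (x n - (μ n)⁻¹ • (A (x m) - (A (x n) - μ n • x n))) := by
      rw [smul_sub, smul_inv_smul₀ hμn]
      abel
    rw [h4, norm_smul]
    nlinarith [hμ n]
  obtain ⟨K, hK, hK'⟩ := hA.image_closedBall_subset_compact 3
  obtain ⟨y, -, ψ, hψ, hψy⟩ :=
    hK.tendsto_subseq (x := fun n => A (x n)) (fun n => hK' ⟨x n, by simp [hxn n], rfl⟩)
  obtain ⟨N, hN⟩ := Metric.cauchySeq_iff'.mp hψy.cauchySeq ε hε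
  have h := hN (N + 1) (Nat.le_succ N)
  rw [dist_eq_norm] at h
  exact absurd h (not_lt.mpr (hlt _ _ (hψ (Nat.lt_succ_self N))))

/-- The non-zero eigenvalues of a compact operator have finite algebraic multiplicity. -/
theorem finiteDimensional_maxGenEigenspace {A : H →L[ℂ] H} (hA : IsCompactOperator A)
    {μ : ℂ} (hμ : μ ≠ 0) :
    FiniteDimensional ℂ (End.maxGenEigenspace (A : End ℂ H) μ) := by
  set S : H →L[ℂ] H := A - μ • 1 with hS
  let V : ℕ → Submodule ℂ H := fun n => LinearMap.ker ((S : End ℂ H) ^ n)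
  have hVmem (n : ℕ) (x : H) : x ∈ V n ↔ (S ^ n) x = 0 := by
    simp only [V, LinearMap.mem_ker]
    rw [← ContinuousLinearMap.coe_coe (S ^ n), ContinuousLinearMap.toLinearMap_pow]
  have hcl (n : ℕ) : IsClosed (V n : Set H) := by
    have : (V n : Set H) = {x | (S ^ n) x = 0} := Set.ext fun x => hVmem n x
    rw [this]
    exact isClosed_eq (S ^ n).continuous continuous_const
  have hsucc (n : ℕ) : V (n + 1) = (V n).comap (S : End ℂ H) := by
    ext x
    simp [V, pow_succ]
  have hmono : Monotone V := by
    refine monotone_nat_of_le_succ fun n x hx => ?_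
    simp only [V, LinearMap.mem_ker] at hx ⊢
    rw [pow_succ']
    simp [hx]
  have hnot : ¬ StrictMono V := by
    refine not_strictMono_of_isCompactOperator hA (norm_pos_iff.mpr hμ) hcl
      (μ := fun _ => μ) (fun _ => le_rfl) fun n x hx => ?_
    rw [hsucc] at hx
    simpa [hS] using hx
  obtain ⟨n, hn⟩ : ∃ n, V (n + 1) = V n := by
    by_contra! h
    exact hnot (strictMono_nat_of_lt_succ fun n =>
      lt_of_le_of_ne (hmono (Nat.le_succ n)) (h n).symm)
  have hstab (m : ℕ) : V (n + m) = V n := by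
    induction m with
    | zero => rfl
    | succ m ih => rw [← add_assoc, hsucc, ih, ← hsucc, hn]
  have hle : End.maxGenEigenspace (A : End ℂ H) μ ≤ V n := by
    intro x hx
    obtain ⟨k, hk⟩ := (End.mem_maxGenEigenspace _ _ _).mp hx
    have hk' : x ∈ V k := by
      simpa [V, hS] using hk
    have := hmono (Nat.le_add_left k n) hk'
    rwa [hstab] at this
  have h1 : FiniteDimensional ℂ (V 1) := by
    apply FiniteDimensional.of_isCompactOperator_id (𝕜 := ℂ)
    have hAV : ∀ v ∈ V 1, A v = μ • v := by
      intro v hv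
      have := (hVmem 1 v).mp hv
      simpa [hS, sub_eq_zero] using this
    have h := (hA.restrict (f := (A : H →ₗ[ℂ] H)) (V := V 1)
      (fun v hv => by
        have := (V 1).smul_mem μ hv
        rwa [← hAV v hv] at this) (hcl 1)).smul μ⁻¹
    refine (congrArg IsCompactOperator ?_).mp h
    funext v
    apply Subtype.ext
    simp [hAV v v.2, smul_smul, inv_mul_cancel₀ hμ]
  have hker : FiniteDimensional ℂ (LinearMap.ker (S : End ℂ H)) := by
    have : V 1 = LinearMap.ker (S : End ℂ H) := by simp [V]
    rw [← this]
    exact h1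
  have hfin (m : ℕ) : FiniteDimensional ℂ (V m) := by
    induction m with
    | zero =>
      have : V 0 = ⊥ := by
        ext x
        simp [V]
      rw [this]
      infer_instance
    | succ m ih =>
      rw [hsucc]
      infer_instance
  have := hfin n
  exact Submodule.finiteDimensional_of_le hle

/-- A compact operator has only finitely many eigenvalues outside a ball around `0`. -/
theorem finite_setOf_hasEigenvalue {A : H →L[ℂ] H} (hA : IsCompactOperator A)
    {ε : ℝ} (hε : 0 < ε) : {μ : ℂ | ε ≤ ‖μ‖ ∧ End.HasEigenvalue (A : End ℂ H) μ}.Finite := by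
  by_contra hinf
  let e := (Set.Infinite.natEmbedding _ hinf)
  let μ : ℕ → ℂ := fun n => (e n : ℂ)
  have hμinj : Function.Injective μ := fun a b h => e.injective (Subtype.ext h)
  have hμ (n : ℕ) : ε ≤ ‖μ n‖ := (e n).2.1
  choose v hv using fun n => (e n).2.2.exists_hasEigenvector
  have hli : LinearIndependent ℂ v :=
    End.eigenvectors_linearIndependent' (A : End ℂ H) μ hμinj v hv
  let V : ℕ → Submodule ℂ H := fun n => Submodule.span ℂ (v '' Set.Iio n)
  have hfin (n : ℕ) : FiniteDimensional ℂ (V n) :=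
    FiniteDimensional.span_of_finite ℂ ((Set.finite_Iio n).image v)
  have hmono : Monotone V := fun a b hab =>
    Submodule.span_mono (Set.image_mono (Set.Iio_subset_Iio hab))
  refine not_strictMono_of_isCompactOperator hA hε
    (fun n => (V n).closed_of_finiteDimensional) hμ (V := V) ?_
    (strictMono_nat_of_lt_succ fun n => lt_of_le_of_ne (hmono (Nat.le_succ n)) fun h => ?_)
  · intro n x hx
    have hAv (k : ℕ) : A (v k) = μ k • v k := (hv k).apply_eq_smul
    induction hx using Submodule.span_induction with
    | mem x hx =>
      obtain ⟨k, hk, rfl⟩ := hx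
      rw [hAv, ← sub_smul]
      rcases Nat.lt_succ_iff_lt_or_eq.mp hk with hk | rfl
      · exact (V n).smul_mem _ (Submodule.subset_span ⟨k, hk, rfl⟩)
      · simp
    | zero => simp
    | add x y _ _ hx hy =>
      have := (V n).add_mem hx hy
      rw [map_add, smul_add]
      convert this using 1
      abel
    | smul a x _ hx =>
      have := (V n).smul_mem a hx
      rw [map_smul, smul_comm (μ n) a, ← smul_sub]
      exact this
  · have hmem : v n ∈ V n := by
      rw [h]
      exact Submodule.subset_span ⟨n, Nat.lt_succ_self n, rfl⟩
    exact hli.notMem_span_image (s := Set.Iio n) (by simp) hmem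

/-- A family of reals with finite upper level sets can be enumerated in decreasing order. -/
theorem exists_antitone_rank {I : Type*} (f : I → ℝ) (hf : ∀ i, {j | f i ≤ f j}.Finite) :
    ∃ rk : I → ℕ, Function.Injective rk ∧ (∀ i n, n ≤ rk i → ∃ j, rk j = n) ∧
      ∀ i j, rk i ≤ rk j → f j ≤ f i := by
  let r : I → I → Prop := fun j i => f i < f j ∨ (f j = f i ∧ WellOrderingRel j i)
  have hirr (i : I) : ¬ r i i := by
    rintro (h | h)
    · exact lt_irrefl _ h
    · exact irrefl_of WellOrderingRel i h.2
  have htrans {a b c : I} (hab : r a b) (hbc : r b c) : r a c := by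
    rcases hab with hab | ⟨hab, hab'⟩ <;> rcases hbc with hbc | ⟨hbc, hbc'⟩
    · exact Or.inl (hbc.trans hab)
    · exact Or.inl (hbc ▸ hab)
    · exact Or.inl (hab ▸ hbc)
    · exact Or.inr ⟨hab.trans hbc, trans_of WellOrderingRel hab' hbc'⟩
  have htri (a b : I) : r a b ∨ a = b ∨ r b a := by
    rcases lt_trichotomy (f a) (f b) with h | h | h
    · exact Or.inr (Or.inr (Or.inl h))
    · rcases trichotomous_of WellOrderingRel a b with h' | h' | h'
      · exact Or.inl (Or.inr ⟨h, h'⟩)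
      · exact Or.inr (Or.inl h')
      · exact Or.inr (Or.inr (Or.inr ⟨h.symm, h'⟩))
    · exact Or.inl (Or.inl h)
  have hfin (i : I) : {j | r j i}.Finite := (hf i).subset fun j hj => by
    rcases hj with h | h
    · exact le_of_lt h
    · exact h.1.ge
  let rk : I → ℕ := fun i => {j | r j i}.ncard
  have hlt {i j : I} (h : r i j) : rk i < rk j :=
    Set.ncard_lt_ncard ⟨fun k hk => htrans hk h, fun hs => hirr i (hs h)⟩ (hfin j)
  have hinj : Function.Injective rk := fun a b hab => by
    rcases htri a b with h | h | h
    · exact absurd hab (hlt h).ne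
    · exact h
    · exact absurd hab (hlt h).ne'
  refine ⟨rk, hinj, fun i n hn => ?_, fun i j hij => ?_⟩
  · rcases hn.eq_or_lt with rfl | hn
    · exact ⟨i, rfl⟩
    · have himg : rk '' {j | r j i} = Set.Iio (rk i) := by
        refine Set.eq_of_subset_of_ncard_le ?_ ?_ (Set.finite_Iio _)
        · rintro _ ⟨j, hj, rfl⟩
          exact hlt hj
        · rw [Set.ncard_image_of_injective _ hinj]
          simp [rk]
      have : n ∈ rk '' {j | r j i} := himg ▸ hn
      obtain ⟨j, -, hj⟩ := this
      exact ⟨j, hj⟩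
  · by_contra! h
    exact absurd hij (not_le.mpr (hlt (Or.inl h)))

/-- Every compact operator has an eigenvalue sequence. -/
theorem exists_isEigenvalueSequence {A : H →L[ℂ] H} (hA : IsCompactOperator A) :
    ∃ l, IsEigenvalueSequence A l := by
  let E : ℂ → Submodule ℂ H := fun μ => End.maxGenEigenspace (A : End ℂ H) μ
  let I := Σ μ : {μ : ℂ // μ ≠ 0}, Fin (finrank ℂ (E μ))
  let ev : I → ℂ := fun i => i.1
  have hev0 (i : I) : ev i ≠ 0 := i.1.2
  have hevE (i : I) : End.HasEigenvalue (A : End ℂ H) (ev i) := by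
    have hpos : 0 < finrank ℂ (E (ev i)) := Fin.pos i.2
    have hne : E (ev i) ≠ ⊥ := by
      intro h
      rw [h, finrank_bot] at hpos
      exact lt_irrefl _ hpos
    by_contra hno
    have h1 : End.eigenspace (A : End ℂ H) (ev i) = ⊥ := not_not.mp hno
    apply hne
    rw [eq_bot_iff]
    intro x hx
    obtain ⟨k, hk⟩ := (End.mem_maxGenEigenspace _ _ _).mp hx
    have hinj : Function.Injective ((A : End ℂ H) - ev i • (1 : End ℂ H)) := by
      rw [← LinearMap.ker_eq_bot]
      rw [End.eigenspace_def] at h1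
      simpa [Algebra.algebraMap_eq_smul_one] using h1
    have hk' : (((A : End ℂ H) - ev i • (1 : End ℂ H)) ^ k) x
        = (((A : End ℂ H) - ev i • (1 : End ℂ H)) ^ k) 0 := by rw [hk, map_zero]
    rw [Module.End.pow_apply, Module.End.pow_apply] at hk'
    exact hinj.iterate k hk'
  have hfin (i : I) : {j : I | ‖ev i‖ ≤ ‖ev j‖}.Finite := by
    have hS := finite_setOf_hasEigenvalue hA (norm_pos_iff.mpr (hev0 i))
    refine Set.Finite.of_finite_fibers ev (hS.subset ?_) fun μ _ => ?_
    · rintro _ ⟨j, hj, rfl⟩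
      exact ⟨hj, hevE j⟩
    · by_cases hμ : μ = 0
      · refine Set.finite_empty.subset ?_
        rintro j ⟨-, hj⟩
        exact hev0 j (hj.trans hμ)
      · refine (Set.finite_range (fun a : Fin (finrank ℂ (E μ)) =>
          (⟨⟨μ, hμ⟩, a⟩ : I))).subset ?_
        rintro ⟨⟨ν, hν⟩, a⟩ ⟨-, hj⟩
        obtain rfl : ν = μ := hj
        exact ⟨a, rfl⟩
  obtain ⟨rk, hinj, hseg, hanti⟩ := exists_antitone_rank (fun i => ‖ev i‖) hfin
  let l : ℕ → ℂ := Function.extend rk ev (fun _ => 0)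
  have hl (i : I) : l (rk i) = ev i := hinj.extend_apply ev _ i
  have hl0 (n : ℕ) (h : ¬ ∃ i, rk i = n) : l n = 0 := Function.extend_apply' ev _ n h
  refine ⟨l, fun m n hmn => ?_, fun μ hμ => ?_⟩
  · by_cases hn : ∃ j, rk j = n
    · obtain ⟨j, rfl⟩ := hn
      obtain ⟨i, rfl⟩ := hseg j m hmn
      simp only [hl]
      exact hanti i j hmn
    · simp [hl0 n hn]
  · have := finiteDimensional_maxGenEigenspace hA hμ
    let g : Fin (finrank ℂ (E μ)) → ℕ := fun a => rk ⟨⟨μ, hμ⟩, a⟩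
    have hg : Function.Injective g := fun a b hab => by
      have h := hinj hab
      exact eq_of_heq (Sigma.mk.inj h).2
    have hset : {k | l k = μ} = Set.range g := by
      ext k
      constructor
      · intro hk
        by_cases hn : ∃ j, rk j = k
        · obtain ⟨⟨⟨ν, hν⟩, a⟩, rfl⟩ := hn
          obtain rfl : ν = μ := (hl _).symm.trans hk
          exact ⟨a, rfl⟩
        · exact absurd ((hl0 k hn).symm.trans hk) hμ.symm
      · rintro ⟨a, rfl⟩
        exact hl _
    rw [hset, algebraicMultiplicity, ← Module.finrank_eq_rank, ← Set.image_univ,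
      hg.encard_image, Set.encard_univ]
    simp [E]

open Classical in
/-- A choice of eigenvalue sequence `λ(A)` of a compact operator `A`. Two choices differ only in
the order of eigenvalues of equal modulus. (The value for operators without an eigenvalue sequence,
which are never compact, is irrelevant.) -/
noncomputable def eigenvalueSequence (A : H →L[ℂ] H) : ℕ → ℂ :=
  if h : ∃ l, IsEigenvalueSequence A l then h.choose else 0

theorem isEigenvalueSequence_eigenvalueSequence {A : H →L[ℂ] H} (hA : IsCompactOperator A) :
    IsEigenvalueSequence A (eigenvalueSequence A) := by
  have h := exists_isEigenvalueSequence hA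
  rw [eigenvalueSequence, dif_pos h]
  exact h.choose_spec

end Eigenvalues

section Classes

/-- Weight sequences: decreasing null sequences of non-negative reals. -/
structure IsWeight (w : ℕ → ℝ) : Prop where
  nonneg : ∀ k, 0 ≤ w k
  antitone : Antitone w
  tendsto_zero : Tendsto w atTop (𝓝 0)

/-- The sequence of successive geometric means of `w`. -/
noncomputable def geometricMean (w : ℕ → ℝ) (k : ℕ) : ℝ :=
  (∏ i ∈ Finset.range (k + 1), w i) ^ (1 / ((k : ℝ) + 1))

variable {H₁ H₂ : Type*} [NormedAddCommGroup H₁] [InnerProductSpace ℂ H₁] [CompleteSpace H₁]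
  [NormedAddCommGroup H₂] [InnerProductSpace ℂ H₂] [CompleteSpace H₂]

/-- The singular values of a compact operator: the square roots of the eigenvalues of `A* A`
(which are non-negative reals). -/
noncomputable def singularValue (A : H₁ →L[ℂ] H₂) (k : ℕ) : ℝ :=
  √(eigenvalueSequence (ContinuousLinearMap.adjoint A ∘L A) k).re

/-- The compactness class `E_w(H₁, H₂)`. -/
def compactnessClass (H₁ H₂ : Type*)
    [NormedAddCommGroup H₁] [InnerProductSpace ℂ H₁] [CompleteSpace H₁]
    [NormedAddCommGroup H₂] [InnerProductSpace ℂ H₂] [CompleteSpace H₂]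
    (w : ℕ → ℝ) : Set (H₁ →L[ℂ] H₂) :=
  {A | IsCompactOperator A ∧ ∃ M : ℝ, 0 ≤ M ∧ ∀ k, singularValue A k ≤ M * w k}

/-- The `w`-gauge `|A|_w` of an operator. -/
noncomputable def operatorGauge (w : ℕ → ℝ) (A : H₁ →L[ℂ] H₂) : ℝ :=
  sInf {M : ℝ | 0 ≤ M ∧ ∀ k, singularValue A k ≤ M * w k}

/-- The sequence space `𝓔_w`. -/
def sequenceClass (w : ℕ → ℝ) : Set (ℕ → ℂ) :=
  {x | ∃ M : ℝ, 0 ≤ M ∧ ∀ k, ‖x k‖ ≤ M * w k}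

/-- The `w`-gauge `|x|_w` of a sequence. -/
noncomputable def sequenceGauge (w : ℕ → ℝ) (x : ℕ → ℂ) : ℝ :=
  sInf {M : ℝ | 0 ≤ M ∧ ∀ k, ‖x k‖ ≤ M * w k}

end Classes

end CompactnessClass

namespace CompactnessClass

open Module

/-! The mechanism is Weyl's multiplicative inequality. If `l k ≠ 0`, the generalised eigenspaces of
the first `k + 1` eigenvalues span a finite-dimensional invariant subspace `V`
(`exists_invariant_submodule`). On `V` every eigenvalue of `A` has modulus at least `‖l k‖`, so the
determinant of the restriction has modulus at least `‖l k‖ ^ dim V` (`pow_finrank_le_norm_det`).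
That modulus is also the product of the singular values of the restriction, each at most the
corresponding singular value of `A` (`singularValues_restrict_le`), hence at most `M * w i` for any
admissible `M`.

The comparison of singular values is a dimension count in the min-max style: `A` is bounded by its
`j`-th singular value on the orthogonal complement of some `W` with `dim W ≤ j`, while the
restriction is bounded below by its own `j`-th singular value at some nonzero vector of `V ∩ Wᗮ`.

Whole eigenspaces are used, so `dim V` may exceed `k + 1`; `pow_le_prod_range_of_le` brings the
inequality back to length `k + 1`. Taking roots and the infimum over `M` gives the bound with the
gauge. -/

/-- The product of an antitone sequence controls powers: a bound `r ^ n ≤ ∏ i < n, a i` descends to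
shorter initial segments. -/
theorem pow_le_prod_range_of_le {a : ℕ → ℝ} (ha : Antitone a) (ha0 : ∀ i, 0 ≤ a i) {r : ℝ}
    (hr : 0 < r) {m n : ℕ} (hmn : m ≤ n) (h : r ^ n ≤ ∏ i ∈ Finset.range n, a i) :
    r ^ m ≤ ∏ i ∈ Finset.range m, a i := by
  induction n, hmn using Nat.le_induction with
  | base => exact h
  | succ n hmn ih =>
    refine ih ?_
    -- If the last factor is at most `r`, cancel it against one `r`; otherwise all earlier factors
    -- are at least `r` too.
    rcases le_total (a n) r with hn | hn
    · rw [Finset.prod_range_succ, pow_succ] at h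
      refine le_of_mul_le_mul_right (h.trans ?_) hr
      exact mul_le_mul_of_nonneg_left hn (Finset.prod_nonneg fun i _ => ha0 i)
    · calc r ^ n = ∏ i ∈ Finset.range n, r := by simp
        _ ≤ ∏ i ∈ Finset.range n, a i :=
          Finset.prod_le_prod (fun _ _ => hr.le) fun i hi =>
            hn.trans (ha (Finset.mem_range.mp hi).le)

/-! ### Finite-dimensional linear algebra: dimensions, determinants, singular values -/

section FiniteDimensional

theorem finiteDimensional_finset_sup_of_mem {K V ι : Type*} [DivisionRing K] [AddCommGroup V]
    [Module K V] {s : Finset ι} {E : ι → Submodule K V}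
    (hfin : ∀ i ∈ s, FiniteDimensional K (E i)) :
    FiniteDimensional K (s.sup E : Submodule K V) := by
  refine Finset.sup_induction (p := fun W : Submodule K V => FiniteDimensional K W)
    (finiteDimensional_bot K V) (fun _ _ _ _ => ?_) hfin
  infer_instance

theorem finrank_finset_sup_le {K V ι : Type*} [DivisionRing K] [AddCommGroup V] [Module K V]
    {s : Finset ι} {E : ι → Submodule K V} (hfin : ∀ i ∈ s, FiniteDimensional K (E i)) :
    finrank K (s.sup E : Submodule K V) ≤ ∑ i ∈ s, finrank K (E i) := by
  classical
  induction s using Finset.induction_on with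
  | empty => rw [Finset.sup_empty, finrank_bot, Finset.sum_empty]
  | insert i s hi ih =>
    have h1 := hfin i (Finset.mem_insert_self i s)
    have hs : ∀ j ∈ s, FiniteDimensional K (E j) := fun j hj =>
      hfin j (Finset.mem_insert_of_mem hj)
    have h2 := finiteDimensional_finset_sup_of_mem hs
    rw [Finset.sup_insert, Finset.sum_insert hi]
    exact (Submodule.finrank_add_le_finrank_add_finrank _ _).trans
      (Nat.add_le_add_left (ih hs) _)

/-- By independence each new subspace meets the span of the others trivially, so no dimension is
lost. This gives the lower bound on the dimension of a sum of generalised eigenspaces. -/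
theorem finrank_finset_sup_eq {K V ι : Type*} [DivisionRing K] [AddCommGroup V] [Module K V]
    {s : Finset ι} {E : ι → Submodule K V} (hE : iSupIndep E)
    (hfin : ∀ i ∈ s, FiniteDimensional K (E i)) :
    finrank K (s.sup E : Submodule K V) = ∑ i ∈ s, finrank K (E i) := by
  classical
  induction s using Finset.induction_on with
  | empty => rw [Finset.sup_empty, finrank_bot, Finset.sum_empty]
  | insert i s hi ih =>
    have h1 := hfin i (Finset.mem_insert_self i s)
    have hs : ∀ j ∈ s, FiniteDimensional K (E j) := fun j hj =>
      hfin j (Finset.mem_insert_of_mem hj)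
    have h2 := finiteDimensional_finset_sup_of_mem hs
    have hd : Disjoint (E i) (s.sup E) := by
      refine (hE i).mono_right (Finset.sup_le fun j hj => ?_)
      have hji : j ≠ i := fun h => hi (h ▸ hj)
      exact le_iSup₂_of_le j hji le_rfl
    rw [Finset.sup_insert, Finset.sum_insert hi, ← ih hs,
      ← Submodule.finrank_sup_add_finrank_inf_eq, hd.eq_bot, finrank_bot, add_zero]

/-- A complex operator whose eigenvalues have modulus at least `r` has determinant at least
`r ^ n` in modulus. -/
theorem pow_finrank_le_norm_det {V : Type*} [AddCommGroup V] [Module ℂ V] [FiniteDimensional ℂ V]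
    (B : End ℂ V) {r : ℝ} (hr : 0 ≤ r) (h : ∀ μ, End.HasEigenvalue B μ → r ≤ ‖μ‖) :
    r ^ finrank ℂ V ≤ ‖LinearMap.det B‖ := by
  have hs := IsAlgClosed.splits B.charpoly
  rw [End.det_eq_prod_roots_charpoly_of_splits hs, ← LinearMap.charpoly_natDegree B,
    hs.natDegree_eq_card_roots]
  have hroots : ∀ μ ∈ B.charpoly.roots, r ≤ ‖μ‖ := fun μ hμ =>
    h μ ((End.hasEigenvalue_iff_isRoot_charpoly B μ).mpr (Polynomial.isRoot_of_mem_roots hμ))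
  -- Only the lower bound on the roots matters from here, so the induction runs over an arbitrary
  -- multiset.
  generalize B.charpoly.roots = s at hroots
  induction s using Multiset.induction_on with
  | empty => simp
  | cons a s ih =>
    rw [Multiset.prod_cons, Multiset.card_cons, pow_succ', norm_mul]
    exact mul_le_mul (hroots a (Multiset.mem_cons_self a s))
      (ih fun μ hμ => hroots μ (Multiset.mem_cons_of_mem hμ)) (pow_nonneg hr _) (norm_nonneg _)

/-- Half of the min-max principle: every subspace of codimension at most `j` contains a nonzero
vector on which `B` is bounded below by its `j`-th singular value. -/
theorem exists_ne_zero_singularValues_mul_norm_le {E F G : Type*}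
    [NormedAddCommGroup E] [InnerProductSpace ℂ E] [FiniteDimensional ℂ E]
    [NormedAddCommGroup F] [InnerProductSpace ℂ F] [FiniteDimensional ℂ F]
    [AddCommGroup G] [Module ℂ G] [FiniteDimensional ℂ G]
    (B : E →ₗ[ℂ] F) (P : E →ₗ[ℂ] G) {j : ℕ} (hG : finrank ℂ G ≤ j) (hj : j < finrank ℂ E) :
    ∃ x ≠ 0, P x = 0 ∧ B.singularValues j * ‖x‖ ≤ ‖B x‖ := by
  set n := finrank ℂ E with hn
  have hT : (LinearMap.adjoint B ∘ₗ B).IsSymmetric :=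
    (LinearMap.isPositive_adjoint_comp_self B).isSymmetric
  set b := hT.eigenvectorBasis hn.symm
  -- `C` reads off the eigenbasis coordinates of index above `j`. Its `n - (j + 1)` conditions and
  -- the at most `j` conditions of `P` number fewer than `n`, so they have a common nonzero
  -- solution.
  let C : E →ₗ[ℂ] ({k : Fin n // j < (k : ℕ)} → ℂ) :=
    LinearMap.pi fun k => (b.toBasis.coord k : E →ₗ[ℂ] ℂ)
  have hcard : Fintype.card {k : Fin n // j < (k : ℕ)} = n - (j + 1) := by
    have : (Finset.univ.filter fun k : Fin n => j < (k : ℕ)) = Finset.Ioi ⟨j, hj⟩ := by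
      ext k
      simp [Fin.lt_def]
    rw [Fintype.card_subtype, this, Fin.card_Ioi]
    simp only
    omega
  have hlt : finrank ℂ (G × ({k : Fin n // j < (k : ℕ)} → ℂ)) < finrank ℂ E := by
    rw [finrank_prod, finrank_fintype_fun_eq_card, hcard]
    omega
  obtain ⟨x, hx, hx0⟩ := Submodule.exists_mem_ne_zero_of_ne_bot
    (LinearMap.ker_ne_bot_of_finrank_lt (f := P.prod C) hlt)
  rw [LinearMap.mem_ker, LinearMap.prod_apply, Function.prod_apply, Prod.mk_eq_zero] at hx
  refine ⟨x, hx0, hx.1, ?_⟩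
  have hcoord (k : Fin n) (hk : j < (k : ℕ)) : b.repr x k = 0 := by
    have := congrFun hx.2 ⟨k, hk⟩
    simpa [C] using this
  have hsq : (B.singularValues j * ‖x‖) ^ 2 ≤ ‖B x‖ ^ 2 := by
    -- Parseval in an eigenbasis of `B* B`. Coordinates above `j` vanish, and the remaining weights
    -- are at least the `j`-th eigenvalue.
    have h1 : ‖B x‖ ^ 2 = ∑ k, hT.eigenvalues hn.symm k * ‖b.repr x k‖ ^ 2 := by
      have h2 : ((‖B x‖ ^ 2 : ℝ) : ℂ) = inner ℂ x ((LinearMap.adjoint B ∘ₗ B) x) := by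
        rw [LinearMap.comp_apply, LinearMap.adjoint_inner_right, inner_self_eq_norm_sq_to_K]
        norm_cast
      rw [← b.repr.inner_map_map, PiLp.inner_apply] at h2
      have h3 (k : Fin n) : b.repr ((LinearMap.adjoint B ∘ₗ B) x) k
          = hT.eigenvalues hn.symm k * b.repr x k :=
        hT.eigenvectorBasis_apply_self_apply hn.symm x k
      apply Complex.ofReal_injective
      rw [h2, Complex.ofReal_sum]
      refine Finset.sum_congr rfl fun k _ => ?_
      rw [h3, RCLike.inner_apply, mul_assoc, RCLike.mul_conj]
      push_cast
      rfl
    have h4 : ‖x‖ ^ 2 = ∑ k, ‖b.repr x k‖ ^ 2 := by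
      rw [← b.repr.norm_map, EuclideanSpace.norm_sq_eq]
    rw [mul_pow, B.sq_singularValues_of_lt hn.symm hj, h1, h4, Finset.mul_sum]
    refine Finset.sum_le_sum fun k _ => ?_
    by_cases hk : j < (k : ℕ)
    · simp [hcoord k hk]
    · refine mul_le_mul_of_nonneg_right ?_ (sq_nonneg _)
      exact hT.eigenvalues_antitone hn.symm (Fin.le_def.mpr (not_lt.mp hk))
  exact le_of_sq_le_sq hsq (norm_nonneg _)

end FiniteDimensional

/-! ### Quadratic forms of compact self-adjoint operators -/

section Hilbert

variable {H : Type*} [NormedAddCommGroup H] [InnerProductSpace ℂ H] [CompleteSpace H]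

/-- The numerical range of a compact self-adjoint operator is bounded by its eigenvalues. -/
theorem re_inner_le_of_hasEigenvalue_le {R : H →L[ℂ] H} (hR : IsCompactOperator R)
    (hsa : IsSelfAdjoint R) {c : ℝ} (hc : 0 ≤ c)
    (h : ∀ a : ℝ, End.HasEigenvalue (R : End ℂ H) (a : ℂ) → a ≤ c) (x : H) :
    (inner ℂ x (R x)).re ≤ c * ‖x‖ ^ 2 := by
  have hle : R ≤ algebraMap ℝ (H →L[ℂ] H) c := by
    refine (le_algebraMap_iff_spectrum_le hsa).mpr fun a ha => ?_
    by_contra! hac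
    -- Since `0 ≤ c < a`, the point `0` is excluded, and a nonzero spectral value of a compact
    -- operator is an eigenvalue.
    have ha0 : (a : ℂ) ≠ 0 := Complex.ofReal_ne_zero.mpr (hc.trans_lt hac).ne'
    have ha' : (a : ℂ) ∈ spectrum ℂ R := (spectrum.algebraMap_mem_iff ℂ).mpr ha
    exact absurd (h a ((hR.hasEigenvalue_iff_mem_spectrum ha0).mpr ha')) (not_le.mpr hac)
  rw [ContinuousLinearMap.le_def] at hle
  have h1 := hle.re_inner_nonneg_right x
  rw [sub_apply, inner_sub_right, map_sub, sub_nonneg] at h1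
  refine h1.trans_eq ?_
  have h2 : algebraMap ℝ (H →L[ℂ] H) c x = (c : ℂ) • x := by
    rw [Algebra.algebraMap_eq_smul_one, Complex.coe_smul]
    rfl
  rw [h2, inner_smul_right, inner_self_eq_norm_sq_to_K]
  change ((c : ℂ) * (‖x‖ : ℂ) ^ 2).re = c * ‖x‖ ^ 2
  norm_cast

/-- On the orthogonal complement of finitely many eigenspaces containing all those of eigenvalues
greater than `c`, the quadratic form of a compact self-adjoint operator is bounded by `c`. -/
theorem re_inner_le_of_mem_orthogonal {T : H →L[ℂ] H} (hT : IsCompactOperator T)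
    (hsa : IsSelfAdjoint T) {c : ℝ} (hc : 0 ≤ c) {S : Finset ℂ}
    [FiniteDimensional ℂ (S.sup fun μ => End.eigenspace (T : End ℂ H) μ : Submodule ℂ H)]
    (hS : ∀ a : ℝ, c < a → End.HasEigenvalue (T : End ℂ H) (a : ℂ) → (a : ℂ) ∈ S) {x : H}
    (hx : x ∈ (S.sup fun μ => End.eigenspace (T : End ℂ H) μ)ᗮ) :
    (inner ℂ x (T x)).re ≤ c * ‖x‖ ^ 2 := by
  set W : Submodule ℂ H := S.sup fun μ => End.eigenspace (T : End ℂ H) μ with hW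
  have hsymm : ∀ x y, inner ℂ (T x) y = inner ℂ x (T y) := hsa.isSymmetric
  have hTW : W ≤ W.comap (T : End ℂ H) := by
    refine Finset.sup_le fun μ hμ y hy => ?_
    have hle : End.eigenspace (T : End ℂ H) μ ≤ W :=
      Finset.le_sup (f := fun μ => End.eigenspace (T : End ℂ H) μ) hμ
    rw [Submodule.mem_comap, End.mem_eigenspace_iff.mp hy]
    exact W.smul_mem μ (hle hy)
  have hTWo (y : H) (hy : y ∈ Wᗮ) : T y ∈ Wᗮ := by
    rw [Submodule.mem_orthogonal] at hy ⊢
    intro u hu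
    rw [← hsymm]
    exact hy _ (hTW hu)
  set Q : H →L[ℂ] H := Wᗮ.starProjection with hQ
  have hQW (y : H) (hy : y ∈ Wᗮ) : Q y = y := Submodule.starProjection_eq_self_iff.mpr hy
  have hQmem (y : H) : Q y ∈ Wᗮ := Submodule.starProjection_apply_mem _ _
  have hQsa : IsSelfAdjoint Q := isSelfAdjoint_starProjection _
  -- The compression to `Wᗮ` is compact and self-adjoint on all of `H` and agrees with `T` on `Wᗮ`.
  -- An eigenvector of `R` for an eigenvalue above `c` lies in `Wᗮ`, hence is an eigenvector of `T`,
  -- hence lies in `W` as well.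
  let R : H →L[ℂ] H := Q * T * Q
  have hR : IsCompactOperator R := (hT.clm_comp Q).comp_clm Q
  have hRsa : IsSelfAdjoint R := by
    have := hsa.conjugate Q
    rwa [hQsa.star_eq] at this
  have key := re_inner_le_of_hasEigenvalue_le hR hRsa hc (fun a ha => ?_) x
  · have : R x = T x := by
      change Q (T (Q x)) = T x
      rw [hQW x hx, hQW _ (hTWo x hx)]
    rwa [this] at key
  · by_contra! hac
    obtain ⟨y, hy⟩ := ha.exists_hasEigenvector
    have ha0 : (a : ℂ) ≠ 0 := Complex.ofReal_ne_zero.mpr (hc.trans_lt hac).ne'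
    have hRy : Q (T (Q y)) = (a : ℂ) • y := hy.apply_eq_smul
    have hyW : y ∈ Wᗮ := by
      rw [← inv_smul_smul₀ ha0 y, ← hRy]
      exact Wᗮ.smul_mem _ (hQmem _)
    rw [hQW y hyW, hQW _ (hTWo y hyW)] at hRy
    have hyE : y ∈ End.eigenspace (T : End ℂ H) (a : ℂ) := End.mem_eigenspace_iff.mpr hRy
    have hyW' : y ∈ W := Finset.le_sup (f := fun μ => End.eigenspace (T : End ℂ H) μ)
      (hS a hac (End.hasEigenvalue_of_hasEigenvector ⟨hyE, hy.2⟩)) hyE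
    exact hy.2 (by
      have := Submodule.inner_right_of_mem_orthogonal hyW' hyW
      exact inner_self_eq_zero.mp this)

end Hilbert

/-! ### Eigenvalue sequences and multiplicity counts -/

section EigenvalueSequence

variable {H : Type*} [NormedAddCommGroup H] [InnerProductSpace ℂ H]

theorem finrank_maxGenEigenspace_eq_encard {A : H →L[ℂ] H} (hA : IsCompactOperator A) {l : ℕ → ℂ}
    (hl : IsEigenvalueSequence A l) {μ : ℂ} (hμ : μ ≠ 0) :
    ((finrank ℂ (End.maxGenEigenspace (A : End ℂ H) μ) : ℕ) : ℕ∞) = {k | l k = μ}.encard := by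
  have := finiteDimensional_maxGenEigenspace hA hμ
  rw [hl.encard_eq μ hμ, algebraicMultiplicity, ← finrank_eq_rank, map_natCast]

theorem exists_eq_of_hasEigenvalue {A : H →L[ℂ] H} (hA : IsCompactOperator A) {l : ℕ → ℂ}
    (hl : IsEigenvalueSequence A l) {μ : ℂ} (hμ : μ ≠ 0)
    (h : End.HasEigenvalue (A : End ℂ H) μ) : ∃ k, l k = μ := by
  have hfd := finiteDimensional_maxGenEigenspace hA hμ
  have hpos : finrank ℂ (End.maxGenEigenspace (A : End ℂ H) μ) ≠ 0 := by
    obtain ⟨y, hy⟩ := h.exists_hasEigenvector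
    intro h0
    rw [Submodule.finrank_eq_zero] at h0
    have := End.eigenspace_le_maxGenEigenspace hy.1
    exact hy.2 ((Submodule.mem_bot ℂ).mp (h0 ▸ this))
  have hne : {k | l k = μ}.encard ≠ 0 := by
    rw [← finrank_maxGenEigenspace_eq_encard hA hl hμ]
    exact_mod_cast hpos
  exact Set.encard_ne_zero.mp hne

theorem hasEigenvalue_of_ne_zero {A : H →L[ℂ] H} (hA : IsCompactOperator A) {l : ℕ → ℂ}
    (hl : IsEigenvalueSequence A l) {k : ℕ} (hk : l k ≠ 0) :
    End.HasEigenvalue (A : End ℂ H) (l k) := by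
  have h1 := finrank_maxGenEigenspace_eq_encard hA hl hk
  have hne : {i | l i = l k}.encard ≠ 0 := Set.encard_ne_zero.mpr ⟨k, rfl⟩
  have h2 : End.HasUnifEigenvalue (A : End ℂ H) (l k) ⊤ := fun h0 => hne <| by
    rw [← h1, Nat.cast_eq_zero]
    have h3 : End.maxGenEigenspace (A : End ℂ H) (l k) = ⊥ := h0
    rw [h3, finrank_bot]
  -- A nontrivial generalised eigenspace already forces an ordinary eigenvector.
  exact h2.lt one_pos

theorem card_filter_le_finrank_maxGenEigenspace {A : H →L[ℂ] H} (hA : IsCompactOperator A)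
    {l : ℕ → ℂ} (hl : IsEigenvalueSequence A l) {μ : ℂ} (hμ : μ ≠ 0) (s : Finset ℕ) :
    (s.filter fun k => l k = μ).card ≤ finrank ℂ (End.maxGenEigenspace (A : End ℂ H) μ) := by
  rw [← Nat.cast_le (α := ℕ∞), finrank_maxGenEigenspace_eq_encard hA hl hμ,
    ← Set.encard_coe_eq_coe_finsetCard]
  exact Set.encard_le_encard fun k hk => (Finset.mem_filter.mp hk).2

theorem finrank_maxGenEigenspace_le_card_filter {A : H →L[ℂ] H} (hA : IsCompactOperator A)
    {l : ℕ → ℂ} (hl : IsEigenvalueSequence A l) {μ : ℂ} (hμ : μ ≠ 0) {s : Finset ℕ}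
    (hs : ∀ k, l k = μ → k ∈ s) :
    finrank ℂ (End.maxGenEigenspace (A : End ℂ H) μ) ≤ (s.filter fun k => l k = μ).card := by
  rw [← Nat.cast_le (α := ℕ∞), finrank_maxGenEigenspace_eq_encard hA hl hμ,
    ← Set.encard_coe_eq_coe_finsetCard]
  exact Set.encard_le_encard fun k hk => Finset.mem_coe.mpr (Finset.mem_filter.mpr ⟨hs k hk, hk⟩)

end EigenvalueSequence

/-! ### Singular values of compact operators -/

section SingularValues

variable {H₁ H₂ : Type*} [NormedAddCommGroup H₁] [InnerProductSpace ℂ H₁] [CompleteSpace H₁]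
  [NormedAddCommGroup H₂] [InnerProductSpace ℂ H₂] [CompleteSpace H₂]

theorem isCompactOperator_adjoint_comp_self {A : H₁ →L[ℂ] H₂} (hA : IsCompactOperator A) :
    IsCompactOperator (ContinuousLinearMap.adjoint A ∘L A) :=
  hA.clm_comp (ContinuousLinearMap.adjoint A)

theorem inner_adjoint_comp_self (A : H₁ →L[ℂ] H₂) (x : H₁) :
    inner ℂ x ((ContinuousLinearMap.adjoint A ∘L A) x) = ((‖A x‖ ^ 2 : ℝ) : ℂ) := by
  rw [ContinuousLinearMap.comp_apply, ContinuousLinearMap.adjoint_inner_right,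
    inner_self_eq_norm_sq_to_K]
  norm_cast

/-- A nonzero eigenvalue of `A* A` with eigenvector `y` equals `‖A y‖² / ‖y‖²`. Hence the real part
in `singularValue` loses nothing. -/
theorem eigenvalueSequence_adjoint_comp_self_eq_norm {A : H₁ →L[ℂ] H₂} (hA : IsCompactOperator A)
    (k : ℕ) : eigenvalueSequence (ContinuousLinearMap.adjoint A ∘L A) k =
      (‖eigenvalueSequence (ContinuousLinearMap.adjoint A ∘L A) k‖ : ℂ) := by
  have hT := isCompactOperator_adjoint_comp_self hA
  set t := eigenvalueSequence (ContinuousLinearMap.adjoint A ∘L A) with ht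
  by_cases hk : t k = 0
  · simp [hk]
  obtain ⟨y, hy⟩ := (hasEigenvalue_of_ne_zero hT
    (isEigenvalueSequence_eigenvalueSequence hT) hk).exists_hasEigenvector
  have h1 : (ContinuousLinearMap.adjoint A ∘L A) y = t k • y := hy.apply_eq_smul
  have h2 := inner_adjoint_comp_self A y
  rw [h1, inner_smul_right, inner_self_eq_norm_sq_to_K] at h2
  have hy0 : ‖y‖ ≠ 0 := norm_ne_zero_iff.mpr hy.2
  have h3 : t k = ((‖A y‖ ^ 2 / ‖y‖ ^ 2 : ℝ) : ℂ) := by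
    rw [Complex.ofReal_div, ← h2]
    push_cast
    exact (mul_div_cancel_right₀ _ (pow_ne_zero 2 (Complex.ofReal_ne_zero.mpr hy0))).symm
  rw [h3, Complex.norm_real, Real.norm_of_nonneg (by positivity)]

theorem singularValue_eq {A : H₁ →L[ℂ] H₂} (hA : IsCompactOperator A) (k : ℕ) :
    singularValue A k = √‖eigenvalueSequence (ContinuousLinearMap.adjoint A ∘L A) k‖ := by
  rw [singularValue, eigenvalueSequence_adjoint_comp_self_eq_norm hA]
  simp

theorem singularValue_nonneg (A : H₁ →L[ℂ] H₂) (k : ℕ) : 0 ≤ singularValue A k :=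
  Real.sqrt_nonneg _

/-- Half of the min-max principle: the operator is bounded by its `j`-th singular value on the
orthogonal complement of a subspace of dimension at most `j`. -/
theorem exists_finrank_le_norm_le_singularValue_mul {A : H₁ →L[ℂ] H₂} (hA : IsCompactOperator A)
    (j : ℕ) : ∃ W : Submodule ℂ H₁, FiniteDimensional ℂ W ∧ finrank ℂ W ≤ j ∧
      ∀ x ∈ Wᗮ, ‖A x‖ ≤ singularValue A j * ‖x‖ := by
  classical
  have hT := isCompactOperator_adjoint_comp_self hA
  have ht := isEigenvalueSequence_eigenvalueSequence hT
  have hre := eigenvalueSequence_adjoint_comp_self_eq_norm hA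
  have hs := singularValue_eq hA j
  have hsa : IsSelfAdjoint (ContinuousLinearMap.adjoint A ∘L A) :=
    (ContinuousLinearMap.isPositive_adjoint_comp_self A).isSelfAdjoint
  have hq := inner_adjoint_comp_self A
  set T := ContinuousLinearMap.adjoint A ∘L A
  set t := eigenvalueSequence T
  have hlt {k : ℕ} (hk : ‖t j‖ < ‖t k‖) : k < j := by
    by_contra! h
    exact absurd (ht.antitone h) (not_le.mpr hk)
  -- The inequality is strict: an eigenvalue tied with `t j` may also occur at index `j` or later,
  -- whereas those in `S` occur only at indices below `j`. Their multiplicities therefore add up to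
  -- at most `j`.
  let S : Finset ℂ := ((Finset.range j).image t).filter fun μ => ‖t j‖ < ‖μ‖
  have hS0 : ∀ μ ∈ S, μ ≠ 0 := fun μ hμ =>
    norm_pos_iff.mp ((norm_nonneg _).trans_lt (Finset.mem_filter.mp hμ).2)
  let E : ℂ → Submodule ℂ H₁ := fun μ => End.eigenspace (T : End ℂ H₁) μ
  have hfd : ∀ μ ∈ S, FiniteDimensional ℂ (E μ) := fun μ hμ => by
    have := finiteDimensional_maxGenEigenspace hT (hS0 μ hμ)
    exact Submodule.finiteDimensional_of_le
      (End.eigenspace_le_maxGenEigenspace (f := (T : End ℂ H₁)) (μ := μ))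
  have hW : FiniteDimensional ℂ (S.sup E : Submodule ℂ H₁) :=
    finiteDimensional_finset_sup_of_mem hfd
  refine ⟨S.sup E, hW, ?_, fun x hx => ?_⟩
  · calc finrank ℂ (S.sup E : Submodule ℂ H₁) ≤ ∑ μ ∈ S, finrank ℂ (E μ) :=
          finrank_finset_sup_le hfd
      _ ≤ ∑ μ ∈ S, ((Finset.range j).filter fun k => t k = μ).card := by
          refine Finset.sum_le_sum fun μ hμ => ?_
          have := finiteDimensional_maxGenEigenspace hT (hS0 μ hμ)
          refine (Submodule.finrank_mono
            (End.eigenspace_le_maxGenEigenspace (f := (T : End ℂ H₁)) (μ := μ))).trans ?_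
          refine finrank_maxGenEigenspace_le_card_filter hT ht (hS0 μ hμ) fun k hk => ?_
          exact Finset.mem_range.mpr (hlt (hk ▸ (Finset.mem_filter.mp hμ).2))
      _ ≤ ∑ μ ∈ (Finset.range j).image t, ((Finset.range j).filter fun k => t k = μ).card :=
          Finset.sum_le_sum_of_subset (Finset.filter_subset _ _)
      _ = j := by
          rw [← Finset.card_eq_sum_card_image, Finset.card_range]
  · have key := re_inner_le_of_mem_orthogonal (S := S) hT hsa (norm_nonneg (t j))
      (fun a ha hev => ?_) hx
    · rw [hq, Complex.ofReal_re] at key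
      refine le_of_sq_le_sq ?_ (mul_nonneg (singularValue_nonneg A j) (norm_nonneg x))
      rwa [mul_pow, hs, Real.sq_sqrt (norm_nonneg _)]
    · have ha0 : 0 < a := (norm_nonneg _).trans_lt ha
      have han : ‖t j‖ < ‖(a : ℂ)‖ := by rwa [Complex.norm_real, Real.norm_of_nonneg ha0.le]
      obtain ⟨k, hk⟩ := exists_eq_of_hasEigenvalue hT ht (Complex.ofReal_ne_zero.mpr ha0.ne') hev
      refine Finset.mem_filter.mpr ⟨Finset.mem_image.mpr ⟨k, ?_, hk⟩, han⟩
      exact Finset.mem_range.mpr (hlt (hk ▸ han))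

end SingularValues

/-! ### Weyl's inequality through invariant subspaces -/

section WeylInequality

variable {H : Type*} [NormedAddCommGroup H] [InnerProductSpace ℂ H]

/-- The singular values of the restriction of an operator to a finite-dimensional invariant
subspace are dominated by those of the operator. -/
theorem singularValues_restrict_le [CompleteSpace H] {A : H →L[ℂ] H} (hA : IsCompactOperator A)
    {V : Submodule ℂ H} [FiniteDimensional ℂ V] (hV : ∀ x ∈ V, (A : End ℂ H) x ∈ V) (j : ℕ) :
    ((A : End ℂ H).restrict hV).singularValues j ≤ singularValue A j := by
  rcases le_or_gt (finrank ℂ V) j with hj | hj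
  · rw [LinearMap.singularValues_of_finrank_le _ hj]
    exact singularValue_nonneg A j
  obtain ⟨W, hW, hWj, hAW⟩ := exists_finrank_le_norm_le_singularValue_mul hA j
  -- The map `P` is the orthogonal projection onto `W` restricted to `V`, so its kernel is `V ∩ Wᗮ`.
  obtain ⟨x, hx0, hPx, hx⟩ := exists_ne_zero_singularValues_mul_norm_le
    ((A : End ℂ H).restrict hV) ((W.orthogonalProjectionOnto : H →ₗ[ℂ] W) ∘ₗ V.subtype) hWj hj
  have hxW : (x : H) ∈ Wᗮ := Submodule.orthogonalProjectionOnto_eq_zero_iff.mp hPx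
  exact le_of_mul_le_mul_right (hx.trans (hAW x hxW)) (norm_pos_iff.mpr hx0)

/-- The modulus of a determinant is the product of the singular values, which are compared factor by
factor. -/
theorem norm_det_restrict_le_prod_singularValue [CompleteSpace H] {A : H →L[ℂ] H}
    (hA : IsCompactOperator A) {V : Submodule ℂ H} [FiniteDimensional ℂ V]
    (hV : ∀ x ∈ V, (A : End ℂ H) x ∈ V) :
    ‖LinearMap.det ((A : End ℂ H).restrict hV)‖ ≤
      ∏ i ∈ Finset.range (finrank ℂ V), singularValue A i := by
  rw [← LinearMap.normDet_eq_norm_det, LinearMap.normDet_eq_prod_singularValues]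
  exact Finset.prod_le_prod (fun i _ => LinearMap.singularValues_nonneg _ i)
    fun i _ => singularValues_restrict_le hA hV i

/-- If the first `n` eigenvalues are nonzero, then the span of their generalised eigenspaces is a
finite-dimensional invariant subspace of dimension at least `n` on which `A` has no further
eigenvalues. -/
theorem exists_invariant_submodule {A : H →L[ℂ] H} (hA : IsCompactOperator A) {l : ℕ → ℂ}
    (hl : IsEigenvalueSequence A l) {n : ℕ} (hn : ∀ i < n, l i ≠ 0) :
    ∃ (V : Submodule ℂ H) (hV : ∀ x ∈ V, (A : End ℂ H) x ∈ V), FiniteDimensional ℂ V ∧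
      n ≤ finrank ℂ V ∧
      ∀ μ, End.HasEigenvalue ((A : End ℂ H).restrict hV) μ → ∃ i < n, l i = μ := by
  classical
  let S : Finset ℂ := (Finset.range n).image l
  let E : ℂ → Submodule ℂ H := End.maxGenEigenspace (A : End ℂ H)
  have hS0 : ∀ μ ∈ S, μ ≠ 0 := fun μ hμ => by
    obtain ⟨i, hi, rfl⟩ := Finset.mem_image.mp hμ
    exact hn i (Finset.mem_range.mp hi)
  have hfd : ∀ μ ∈ S, FiniteDimensional ℂ (E μ) := fun μ hμ =>
    finiteDimensional_maxGenEigenspace hA (hS0 μ hμ)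
  have hind : iSupIndep E := End.independent_maxGenEigenspace _
  have hV : S.sup E ≤ (S.sup E).comap (A : End ℂ H) := Finset.sup_le fun μ hμ y hy =>
    Finset.le_sup (f := E) hμ (End.mapsTo_maxGenEigenspace_of_comm (Commute.refl _) μ hy)
  refine ⟨S.sup E, hV, finiteDimensional_finset_sup_of_mem hfd, ?_, fun μ hμ => ?_⟩
  · rw [finrank_finset_sup_eq hind hfd]
    calc n = ∑ μ ∈ S, ((Finset.range n).filter fun k => l k = μ).card := by
          rw [← Finset.card_eq_sum_card_image, Finset.card_range]
      _ ≤ _ := Finset.sum_le_sum fun μ hμ =>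
          card_filter_le_finrank_maxGenEigenspace hA hl (hS0 μ hμ) _
  · obtain ⟨y, hy⟩ := hμ.exists_hasEigenvector
    by_contra! hno
    have hyE : (y : H) ∈ E μ := by
      refine End.eigenspace_le_maxGenEigenspace (End.mem_eigenspace_iff.mpr ?_)
      exact congrArg Subtype.val hy.apply_eq_smul
    -- A `μ` outside the list has a generalised eigenspace independent of those spanning the
    -- subspace, so it has no eigenvector there.
    have hd : Disjoint (E μ) (S.sup E) := by
      refine (hind μ).mono_right (Finset.sup_le fun ν hν => ?_)
      obtain ⟨i, hi, rfl⟩ := Finset.mem_image.mp hν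
      exact le_iSup₂_of_le (l i) (hno i (Finset.mem_range.mp hi)) le_rfl
    exact hy.2 (Subtype.ext (Submodule.disjoint_def.mp hd y hyE y.2))

/-- A consequence of Weyl's inequality for an antitone majorant of the singular values. -/
theorem norm_pow_le_prod_of_singularValue_le [CompleteSpace H] {A : H →L[ℂ] H}
    (hA : IsCompactOperator A) {l : ℕ → ℂ} (hl : IsEigenvalueSequence A l) {a : ℕ → ℝ}
    (ha : Antitone a) (hs : ∀ k, singularValue A k ≤ a k) (k : ℕ) :
    ‖l k‖ ^ (k + 1) ≤ ∏ i ∈ Finset.range (k + 1), a i := by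
  have ha0 (i : ℕ) : 0 ≤ a i := (singularValue_nonneg A i).trans (hs i)
  by_cases hk : l k = 0
  · rw [hk, norm_zero, zero_pow (Nat.succ_ne_zero k)]
    exact Finset.prod_nonneg fun i _ => ha0 i
  have hr : 0 < ‖l k‖ := norm_pos_iff.mpr hk
  have hle : ∀ i < k + 1, ‖l k‖ ≤ ‖l i‖ := fun i hi => hl.antitone (Nat.lt_succ_iff.mp hi)
  obtain ⟨V, hV, hfd, hdim, hev⟩ := exists_invariant_submodule hA hl (n := k + 1)
    fun i hi => norm_pos_iff.mp (hr.trans_le (hle i hi))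
  -- The dimension of `V` exceeds `k + 1` when one of the listed eigenvalues recurs after index `k`.
  refine pow_le_prod_range_of_le ha ha0 hr hdim ?_
  calc ‖l k‖ ^ finrank ℂ V ≤ ‖LinearMap.det ((A : End ℂ H).restrict hV)‖ :=
        pow_finrank_le_norm_det _ hr.le fun μ hμ => by
          obtain ⟨i, hi, rfl⟩ := hev μ hμ
          exact hle i hi
    _ ≤ ∏ i ∈ Finset.range (finrank ℂ V), singularValue A i :=
        norm_det_restrict_le_prod_singularValue hA hV
    _ ≤ _ := Finset.prod_le_prod (fun i _ => singularValue_nonneg A i) fun i _ => hs i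

end WeylInequality

/-! ### Geometric means and the gauge estimate -/

theorem geometricMean_nonneg {w : ℕ → ℝ} (hw : ∀ i, 0 ≤ w i) (k : ℕ) : 0 ≤ geometricMean w k :=
  Real.rpow_nonneg (Finset.prod_nonneg fun i _ => hw i) _

theorem geometricMean_pow {w : ℕ → ℝ} (hw : ∀ i, 0 ≤ w i) (k : ℕ) :
    geometricMean w k ^ (k + 1) = ∏ i ∈ Finset.range (k + 1), w i := by
  rw [geometricMean, ← Nat.cast_succ, one_div]
  exact Real.rpow_inv_natCast_pow (Finset.prod_nonneg fun i _ => hw i) (Nat.succ_ne_zero k)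

end CompactnessClass

open CompactnessClass in
theorem proposition3p12 {H : Type*} [NormedAddCommGroup H] [InnerProductSpace ℂ H]
    [CompleteSpace H] [TopologicalSpace.SeparableSpace H] (w : ℕ → ℝ) (hw : IsWeight w)
    (A : H →L[ℂ] H) (hA : A ∈ compactnessClass H H w)
    (l : ℕ → ℂ) (hl : IsEigenvalueSequence A l) :
    l ∈ sequenceClass (geometricMean w) ∧
      sequenceGauge (geometricMean w) l ≤ operatorGauge w A ∧
      ∀ k, ‖l k‖ ≤ operatorGauge w A * geometricMean w k := by
  obtain ⟨hAc, hne⟩ := hA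
  have hg := geometricMean_nonneg hw.nonneg
  have hgauge0 : 0 ≤ operatorGauge w A := Real.sInf_nonneg fun M hM => hM.1
  have hM (M : ℝ) (hM0 : 0 ≤ M) (hs : ∀ k, singularValue A k ≤ M * w k) (k : ℕ) :
      ‖l k‖ ≤ M * geometricMean w k := by
    have h := norm_pow_le_prod_of_singularValue_le hAc hl (a := fun k => M * w k)
      (fun i j hij => mul_le_mul_of_nonneg_left (hw.antitone hij) hM0) hs k
    rw [Finset.prod_mul_distrib, Finset.prod_const, Finset.card_range,
      ← geometricMean_pow hw.nonneg, ← mul_pow] at h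
    exact le_of_pow_le_pow_left₀ (Nat.succ_ne_zero k) (mul_nonneg hM0 (hg k)) h
  have hbound (k : ℕ) : ‖l k‖ ≤ operatorGauge w A * geometricMean w k := by
    -- A positive mean can be divided out, which makes the quotient a lower bound for all admissible
    -- `M`. If the mean is zero, any one admissible `M` already gives `l k = 0`.
    rcases (hg k).eq_or_lt with h0 | hpos
    · obtain ⟨M, hM0, hs⟩ := hne
      have := hM M hM0 hs k
      rw [← h0, mul_zero] at this ⊢
      exact this
    · rw [← div_le_iff₀ hpos]
      exact le_csInf hne fun M hM' => (div_le_iff₀ hpos).mpr (hM M hM'.1 hM'.2 k)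
  exact ⟨⟨_, hgauge0, hbound⟩, csInf_le ⟨0, fun M hM' => hM'.1⟩ ⟨hgauge0, hbound⟩, hbound⟩
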